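/- Let $E$ be a complex vector space of dimension $3$, let $E^*$ be its dual, and let $$\mathbb Q^4=\{[e+f]\in\mathbb P(E\oplus E^*) : e\in E,\ f\in E^*,\ \langle e,f\rangle=0\}.$$ Fix a nonzero volume form $\omega\in\wedge^3E^*$ and identify $\wedge^2E$ with $E^*$ by $x\wedge y\mapsto\omega(x,y,\cdot)$. Let the group $SL(E)\ltimes E^*$ act linearly on $E\oplus E^*\simeq E\oplus\wedge^2E$ as follows: $g\in SL(E)$ acts by the natural representations on $E$ and $E^*$, and $\alpha\in E^*$ acts by $e+w\mapsto (e+\iota_\alpha w)+w$ for $e\in E$, $w\in\wedge^2E$, where $\iota_\alpha:\wedge^2E\to E$ is the interior product, $\iota_\alpha(x\wedge y)=\alpha(x)y-\alpha(y)x$. This action preserves $\mathbb Q^4$. Let $\mathcal K$ be the space of all projective planes $\mathbb P^2=\mathbb P(W)$ (with $W\subset E\oplus E^*$ a linear subspace of dimension $3$) contained in $\mathbb Q^4$, with its classical topology as a subspace of the Grassmannian of $3$-dimensional subspaces of $E\oplus E^*$. Then $\mathcal K$ has exactly two connected components, and each of them is the union of exactly two orbits of $SL(E)\ltimes E^*$,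 one of which is closed and the other open. -/

import Mathlib

open Module
open scoped LinearAlgebra.Projectivization

noncomputable section

namespace Q4Planes

/-! ### Grassmannians of complex vector spaces with their classical topology -/

section Grassmannian

variable (V : Type*) [AddCommGroup V] [Module ℂ V] (k : ℕ)

/-- The Grassmannian of `k`-dimensional linear subspaces of the complex vector space `V`. -/
def Gr : Type _ := {W : Submodule ℂ V // finrank ℂ W = k}

/-- Linearly independent `k`-tuples of vectors of `V`. -/
def Frame : Type _ := {v : Fin k → V // LinearIndependent ℂ v}

variable {V k} in
/-- The `k`-dimensional subspace spanned by a `k`-frame. -/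
def Frame.span (v : Frame V k) : Gr V k :=
  ⟨Submodule.span ℂ (Set.range v.1), by simpa using finrank_span_eq_card v.2⟩

/-- Frames are topologized as a subset of `V ^ k`. The module topology of a finite-dimensional
complex vector space is its usual topology. -/
instance : TopologicalSpace (Frame V k) :=
  TopologicalSpace.induced Subtype.val (moduleTopology ℂ (Fin k → V))

/-- The classical topology of the Grassmannian: the quotient topology from the space of frames. -/
instance : TopologicalSpace (Gr V k) :=
  TopologicalSpace.coinduced Frame.span inferInstance

end Grassmannian

variable (E : Type*) [AddCommGroup E] [Module ℂ E]

/-! ### The quadric and the planes contained in it -/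

/-- The quadric `{[e + f] : ⟨e, f⟩ = 0}` in `ℙ(E ⊕ E*)`. It is `ℚ⁴` if `dim E = 3`. -/
def quadric : Set (ℙ ℂ (E × Dual ℂ E)) :=
  {p | ∀ v ∈ p.submodule, v.2 v.1 = 0}

/-- The space of projective planes `ℙ(W)`, `dim W = 3`, in `ℙ(E ⊕ E*)` that are contained
in the quadric. -/
def QuadricPlane : Type _ :=
  {W : Gr (E × Dual ℂ E) 3 // ∀ p : ℙ ℂ (E × Dual ℂ E), p.submodule ≤ W.1 → p ∈ quadric E}

/-- The subspace topology from the Grassmannian. -/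
instance : TopologicalSpace (QuadricPlane E) :=
  TopologicalSpace.induced Subtype.val inferInstance

variable {E}

/-! ### The group `SL(E) ⋉ E*` -/

variable (E) in
/-- The contragredient action of `SL(E)` on (the additive group of) `E*`,
`(g • α)(x) = α (g⁻¹ x)`. -/
def contragredient : SpecialLinearGroup ℂ E →* MulAut (Multiplicative (Dual ℂ E)) where
  toFun g := AddEquiv.toMultiplicative (g.1.symm.dualMap.toAddEquiv)
  map_one' := rfl
  map_mul' _ _ := rfl

variable (E) in
/-- The group `SL(E) ⋉ E*`. -/
abbrev SLDual : Type _ := Multiplicative (Dual ℂ E) ⋊[contragredient E] SpecialLinearGroup ℂ E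

/-! ### The identification of `⋀² E` with `E*` and the interior product -/

/-- The interior product `⋀² E → E` with a linear form `α`:
`x ∧ y ↦ α(x) y - α(y) x`. -/
def interior (α : Dual ℂ E) : ⋀[ℂ]^2 E →ₗ[ℂ] E :=
  exteriorPower.alternatingMapLinearEquiv
    { toFun := fun v => α (v 0) • v 1 - α (v 1) • v 0
      map_update_add' := by
        intro inst v i x y
        rw [Subsingleton.elim inst (instDecidableEqFin 2)]
        fin_cases i <;> simp [add_smul] <;> abel
      map_update_smul' := by
        intro inst v i c x
        rw [Subsingleton.elim inst (instDecidableEqFin 2)]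
        fin_cases i <;> simp [smul_sub, mul_smul, smul_comm c]
      map_eq_zero_of_eq' := by
        intro v i j h hij
        fin_cases i <;> fin_cases j <;> simp_all }

theorem interior_wedge (α : Dual ℂ E) (x y : E) :
    interior α (exteriorPower.ιMulti ℂ 2 ![x, y]) = α x • y - α y • x := by
  simp [interior]

/-- The linear map `⋀² E → E*`, `x ∧ y ↦ ω(·, x, y) = ω(x, y, ·)`. -/
def wedgeToDual (ω : E [⋀^Fin 3]→ₗ[ℂ] ℂ) : ⋀[ℂ]^2 E →ₗ[ℂ] Dual ℂ E :=
  ((exteriorPower.alternatingMapLinearEquiv (R := ℂ) (M := E) (N := ℂ) (n := 2)).toLinearMap ∘ₗ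
    ω.curryLeft).flip

theorem wedgeToDual_wedge (ω : E [⋀^Fin 3]→ₗ[ℂ] ℂ) (x y z : E) :
    wedgeToDual ω (exteriorPower.ιMulti ℂ 2 ![x, y]) z = ω ![z, x, y] := by
  simp [wedgeToDual]

theorem exists_basis (hE : finrank ℂ E = 3) {ω : E [⋀^Fin 3]→ₗ[ℂ] ℂ} (hω : ω ≠ 0) :
    ∃ b : Basis (Fin 3) ℂ E, ∃ c : ℂ, c ≠ 0 ∧ ω = c • b.det := by
  have : FiniteDimensional ℂ E := FiniteDimensional.of_finrank_pos (by omega)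
  refine ⟨finBasisOfFinrankEq ℂ E hE, ω (finBasisOfFinrankEq ℂ E hE), fun h => hω ?_,
    ω.eq_smul_basis_det _⟩
  rw [ω.eq_smul_basis_det (finBasisOfFinrankEq ℂ E hE), h, zero_smul]

theorem wedgeToDual_bijective (hE : finrank ℂ E = 3) {ω : E [⋀^Fin 3]→ₗ[ℂ] ℂ} (hω : ω ≠ 0) :
    Function.Bijective (wedgeToDual ω) := by
  have : FiniteDimensional ℂ E := FiniteDimensional.of_finrank_pos (by omega)
  have hfr : finrank ℂ (⋀[ℂ]^2 E) = finrank ℂ (Dual ℂ E) := by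
    rw [exteriorPower.finrank_eq, Subspace.dual_finrank_eq, hE]; rfl
  have hs : Function.Surjective (wedgeToDual ω) := by
    obtain ⟨b, c, hc, rfl⟩ := exists_basis hE hω
    intro β
    refine ⟨c⁻¹ • (β (b 0) • exteriorPower.ιMulti ℂ 2 ![b 1, b 2]
      + β (b 1) • exteriorPower.ιMulti ℂ 2 ![b 2, b 0]
      + β (b 2) • exteriorPower.ιMulti ℂ 2 ![b 0, b 1]), b.ext fun i => ?_⟩
    simp only [map_smul, map_add, LinearMap.smul_apply, LinearMap.add_apply, wedgeToDual_wedge,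
      AlternatingMap.smul_apply, Basis.det_apply, Matrix.det_fin_three, Basis.toMatrix_apply]
    fin_cases i <;> simp <;> field_simp
  exact ⟨(LinearMap.injective_iff_surjective_of_finrank_eq_finrank hfr).2 hs, hs⟩

/-- The isomorphism `⋀² E ≃ E*` given by a volume form `ω` on `E`. -/
def wedgeEquivDual (hE : finrank ℂ E = 3) {ω : E [⋀^Fin 3]→ₗ[ℂ] ℂ} (hω : ω ≠ 0) :
    ⋀[ℂ]^2 E ≃ₗ[ℂ] Dual ℂ E :=
  LinearEquiv.ofBijective (wedgeToDual ω) (wedgeToDual_bijective hE hω)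

/-- The interior product with `α`, seen as a map `E* ≃ ⋀² E → E`. -/
def interiorDual (hE : finrank ℂ E = 3) {ω : E [⋀^Fin 3]→ₗ[ℂ] ℂ} (hω : ω ≠ 0)
    (α : Dual ℂ E) : Dual ℂ E →ₗ[ℂ] E :=
  interior α ∘ₗ (wedgeEquivDual hE hω).symm.toLinearMap

theorem wedge_induction {p : ⋀[ℂ]^2 E → Prop}
    (h1 : ∀ x y, p (exteriorPower.ιMulti ℂ 2 ![x, y])) (h0 : p 0)
    (ha : ∀ a b, p a → p b → p (a + b)) (hs : ∀ (c : ℂ) a, p a → p (c • a)) (w : ⋀[ℂ]^2 E) :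
    p w := by
  have hw : w ∈ Submodule.span ℂ (Set.range (exteriorPower.ιMulti ℂ 2 (M := E))) := by
    rw [exteriorPower.ιMulti_span]; trivial
  induction hw using Submodule.span_induction with
  | mem x hx =>
    obtain ⟨v, rfl⟩ := hx
    have : v = ![v 0, v 1] := by ext i; fin_cases i <;> rfl
    rw [this]; exact h1 _ _
  | zero => exact h0
  | add x y _ _ hx hy => exact ha _ _ hx hy
  | smul c x _ hx => exact hs _ _ hx

theorem interiorDual_add (hE : finrank ℂ E = 3) {ω : E [⋀^Fin 3]→ₗ[ℂ] ℂ} (hω : ω ≠ 0)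
    (α α' β : Dual ℂ E) :
    interiorDual hE hω (α + α') β = interiorDual hE hω α β + interiorDual hE hω α' β := by
  simp only [interiorDual, LinearMap.comp_apply]
  generalize (wedgeEquivDual hE hω).symm.toLinearMap β = w
  induction w using wedge_induction with
  | h1 x y => simp only [interior_wedge, LinearMap.add_apply, add_smul]; abel
  | h0 => simp
  | ha a b ha hb => simp only [map_add, ha, hb]; abel
  | hs c a ha => simp only [map_smul, ha, smul_add]

theorem interiorDual_equivariant (hE : finrank ℂ E = 3) {ω : E [⋀^Fin 3]→ₗ[ℂ] ℂ} (hω : ω ≠ 0)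
    (g : SpecialLinearGroup ℂ E) (α β : Dual ℂ E) :
    interiorDual hE hω (g.1.symm.dualMap α) (g.1.symm.dualMap β) =
      g.1 (interiorDual hE hω α β) := by
  obtain ⟨w, rfl⟩ := (wedgeEquivDual hE hω).surjective β
  have key : g.1.symm.dualMap (wedgeEquivDual hE hω w) =
      wedgeEquivDual hE hω (exteriorPower.map 2 g.1.toLinearMap w) := by
    induction w using wedge_induction with
    | h1 x y =>
      ext z
      have hdet : ∀ v : Fin 3 → E, ω (fun i => g.1 (v i)) = ω v := by
        intro v
        obtain ⟨b, c, hc, rfl⟩ := exists_basis hE hω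
        have := b.det_comp g.1.toLinearMap v
        rw [SpecialLinearGroup.det_eq_one, one_mul] at this
        simp only [AlternatingMap.smul_apply]
        rw [← this]; rfl
      rw [exteriorPower.map_apply_ιMulti]
      have h2 : (g.1.toLinearMap ∘ ![x, y]) = ![g.1 x, g.1 y] := by
        ext i; fin_cases i <;> rfl
      rw [h2]
      change wedgeToDual ω _ (g.1.symm z) = wedgeToDual ω _ z
      rw [wedgeToDual_wedge, wedgeToDual_wedge, ← hdet]
      congr 1
      ext i; fin_cases i <;> simp
    | h0 => simp
    | ha a b ha hb => simp only [map_add, ha, hb]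
    | hs c a ha => simp only [map_smul, ha]
  rw [key]
  simp only [interiorDual, LinearMap.comp_apply, LinearEquiv.coe_coe,
    LinearEquiv.symm_apply_apply]
  clear key
  induction w using wedge_induction with
  | h1 x y =>
    have h2 : (g.1.toLinearMap ∘ ![x, y]) = ![g.1 x, g.1 y] := by
      ext i; fin_cases i <;> rfl
    rw [exteriorPower.map_apply_ιMulti, h2, interior_wedge, interior_wedge]
    simp
  | h0 => simp
  | ha a b ha hb => simp only [map_add, ha, hb]
  | hs c a ha => simp only [map_smul, ha]

theorem apply_interiorDual_self (hE : finrank ℂ E = 3) {ω : E [⋀^Fin 3]→ₗ[ℂ] ℂ} (hω : ω ≠ 0)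
    (α β : Dual ℂ E) : β (interiorDual hE hω α β) = 0 := by
  have hpol : ∀ w w', wedgeEquivDual hE hω w (interior α w') +
      wedgeEquivDual hE hω w' (interior α w) = 0 := by
    intro w w'
    induction w using wedge_induction with
    | h1 x y =>
      induction w' using wedge_induction with
      | h1 x' y' =>
        change wedgeToDual ω _ _ + wedgeToDual ω _ _ = 0
        rw [interior_wedge, interior_wedge, wedgeToDual_wedge, wedgeToDual_wedge]
        obtain ⟨b, c, hc, rfl⟩ := exists_basis hE hω
        have hα : ∀ z, α z = b.repr z 0 * α (b 0) + b.repr z 1 * α (b 1)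
            + b.repr z 2 * α (b 2) := by
          intro z
          have hz := congrArg α (b.sum_repr z)
          rw [Fin.sum_univ_three] at hz
          simpa using hz.symm
        simp only [AlternatingMap.smul_apply, Basis.det_apply, Matrix.det_fin_three,
          Basis.toMatrix_apply]
        simp only [hα x, hα y, hα x', hα y', map_sub, map_smul, Finsupp.sub_apply,
          Finsupp.smul_apply, smul_eq_mul, Matrix.cons_val_zero, Matrix.cons_val_one,
          Matrix.cons_val]
        ring
      | h0 => simp
      | ha a b ha hb => simp only [map_add, LinearMap.add_apply]; linear_combination ha + hb
      | hs c a ha =>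
        simp only [map_smul, LinearMap.smul_apply, smul_eq_mul]; linear_combination c * ha
    | h0 => simp
    | ha a b ha hb => simp only [map_add, LinearMap.add_apply]; linear_combination ha + hb
    | hs c a ha =>
      simp only [map_smul, LinearMap.smul_apply, smul_eq_mul]; linear_combination c * ha
  have := hpol ((wedgeEquivDual hE hω).symm β) ((wedgeEquivDual hE hω).symm β)
  rw [LinearEquiv.apply_symm_apply] at this
  have h2 : (2 : ℂ) * β (interiorDual hE hω α β) = 0 := by
    rw [two_mul]; exact this
  simpa using h2

theorem interiorDual_zero (hE : finrank ℂ E = 3) {ω : E [⋀^Fin 3]→ₗ[ℂ] ℂ} (hω : ω ≠ 0) :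
    interiorDual hE hω 0 = 0 := by
  ext β
  simpa using interiorDual_add hE hω 0 0 β

/-! ### The action on `E ⊕ E*` and on planes -/

/-- The action of `SL(E) ⋉ E*` on `E ⊕ E* ≃ E ⊕ ⋀² E`: the element `(α, g)` first acts by `g`
(by the standard and the contragredient representation), and then `α` acts by the interior product,
`(e, f) ↦ (e + ι_α f, f)`. -/
def rep (hE : finrank ℂ E = 3) {ω : E [⋀^Fin 3]→ₗ[ℂ] ℂ} (hω : ω ≠ 0) :
    SLDual E →* Module.End ℂ (E × Dual ℂ E) where
  toFun h :=
    { toFun := fun v =>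
        (h.right.1 v.1 + interiorDual hE hω h.left.toAdd (h.right.1.symm.dualMap v.2),
          h.right.1.symm.dualMap v.2)
      map_add' := by
        intro v w
        ext1
        · simp only [Prod.fst_add, Prod.snd_add, map_add]; abel
        · simp
      map_smul' := by
        intro c v
        ext1
        · simp
        · simp }
  map_one' := by
    ext v <;> simp [interiorDual_zero] <;> rfl
  map_mul' h h' := by
    refine LinearMap.ext fun v => Prod.ext ?_ rfl
    change (h.right.1 (h'.right.1 v.1) + interiorDual hE hω
        (h.left.toAdd + h.right.1.symm.dualMap h'.left.toAdd)
        (h.right.1.symm.dualMap (h'.right.1.symm.dualMap v.2)) =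
      h.right.1 (h'.right.1 v.1 + interiorDual hE hω h'.left.toAdd (h'.right.1.symm.dualMap v.2))
        + interiorDual hE hω h.left.toAdd (h.right.1.symm.dualMap (h'.right.1.symm.dualMap v.2)))
    rw [interiorDual_add, interiorDual_equivariant, map_add]
    abel

theorem rep_isotropic (hE : finrank ℂ E = 3) {ω : E [⋀^Fin 3]→ₗ[ℂ] ℂ} (hω : ω ≠ 0)
    (h : SLDual E) (v : E × Dual ℂ E) : (rep hE hω h v).2 (rep hE hω h v).1 = v.2 v.1 := by
  change h.right.1.symm.dualMap v.2 (h.right.1 v.1 + interiorDual hE hω h.left.toAdd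
    (h.right.1.symm.dualMap v.2)) = _
  rw [map_add, apply_interiorDual_self]
  simp

theorem rep_injective (hE : finrank ℂ E = 3) {ω : E [⋀^Fin 3]→ₗ[ℂ] ℂ} (hω : ω ≠ 0)
    (h : SLDual E) : Function.Injective (rep hE hω h) := by
  refine Function.LeftInverse.injective (g := rep hE hω h⁻¹) fun v => ?_
  rw [← Module.End.mul_apply, ← map_mul]
  simp

theorem isotropic_iff (W : Submodule ℂ (E × Dual ℂ E)) :
    (∀ p : ℙ ℂ (E × Dual ℂ E), p.submodule ≤ W → p ∈ quadric E) ↔ ∀ v ∈ W, v.2 v.1 = 0 := by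
  constructor
  · intro H v hv
    by_cases h0 : v = 0
    · simp [h0]
    · refine H (Projectivization.mk ℂ v h0) ?_ v ?_
      · rw [Projectivization.submodule_mk, Submodule.span_singleton_le_iff_mem]; exact hv
      · rw [Projectivization.submodule_mk]; exact Submodule.mem_span_singleton_self v
  · intro H p hp v hv
    exact H v (hp hv)

/-- The induced action of `SL(E) ⋉ E*` on the space of planes in the quadric:
`h • ℙ(W) = ℙ(h W)`. -/
@[reducible]
def planeAction (hE : finrank ℂ E = 3) {ω : E [⋀^Fin 3]→ₗ[ℂ] ℂ} (hω : ω ≠ 0) :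
    MulAction (SLDual E) (QuadricPlane E) where
  smul h P := ⟨⟨P.1.1.map (rep hE hω h), by
      exact (Submodule.equivMapOfInjective _ (rep_injective hE hω h) P.1.1).symm.finrank_eq.trans
        P.1.2⟩, by
      rw [isotropic_iff]
      rintro _ ⟨v, hv, rfl⟩
      rw [rep_isotropic]
      exact (isotropic_iff _).1 P.2 v hv⟩
  one_smul P := by
    refine Subtype.ext (Subtype.ext ?_)
    change P.1.1.map (rep hE hω 1) = _
    rw [map_one]; exact Submodule.map_id _
  mul_smul h h' P := by
    refine Subtype.ext (Subtype.ext ?_)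
    change P.1.1.map (rep hE hω (h * h')) = (P.1.1.map (rep hE hω h')).map (rep hE hω h)
    rw [map_mul]; exact Submodule.map_comp _ _ _

/-- The `SL(E) ⋉ E*`-orbit of a plane in the quadric. -/
def planeOrbit (hE : finrank ℂ E = 3) {ω : E [⋀^Fin 3]→ₗ[ℂ] ℂ} (hω : ω ≠ 0)
    (P : QuadricPlane E) : Set (QuadricPlane E) :=
  letI := planeAction hE hω
  MulAction.orbit (SLDual E) P

end Q4Planes

end

open Module
open scoped LinearAlgebra.Projectivization

namespace Q4Planes

/-! ### Open subsets of the Grassmannian -/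

section Topology

variable {V : Type*} [AddCommGroup V] [Module ℂ V]

/-! Everything is governed by `d = dim (W ∩ E)`, which takes the values 0, 1, 2, 3. Write `K = W ∩
E`.

Orbits are the level sets of `d` (`planeOrbit_eq`). Isotropy and a dimension count show that `W`
projects onto `K^⊥` in `E*` (`QuadricPlane.map_snd`). Hence `W` is given by `K` together with a map
`K^⊥ → E`, defined modulo `K`, which is alternating. It extends to an alternating map `E* → E`, and
in dimension 3 every such map is an `ι_α` (`exists_interiorDual_eq`). So `α` carries `K ⊕ K^⊥` to
`W` (`exists_shear_splitPlane`), and `SL(E)` is transitive on subspaces `K` of given dimension.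

The parity of `d` is locally constant (`isOpen_odd`, `isOpen_even`): two maximal isotropic subspaces
of a 6-dimensional quadratic space that meet only in 0 belong to opposite families, and
transversality is an open condition. Concretely, a plane transverse to `E*` has odd `d`, a plane
transverse to `K ⊕ K^⊥` with `dim K = 1` has even `d`, and each plane can be put in such a position,
in the odd case after moving it by the group.

Each parity class is connected. Unipotent isometries `1 + tN` trace connected families: those from
`E*` to `E` deform `W` to `K ⊕ K^⊥`, and the opposite ones, from `E` to `E*`, join `d = 3` to `d =
1` and `d = 2` to `d = 0`.

Finally `d = 0` and `d ≠ 3` are open conditions. With the parity classes open, this makes the orbits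
0 and 1 open and the orbits 2 and 3 closed. -/

theorem isOpen_gr_iff {k : ℕ} {s : Set (Gr V k)} : IsOpen s ↔ IsOpen (Frame.span ⁻¹' s) :=
  isOpen_coinduced

theorem continuous_frame_linear {k : ℕ} (φ : (Fin k → V) →ₗ[ℂ] ℂ) :
    Continuous fun v : Frame V k => φ v.1 := by
  let _ : TopologicalSpace (Fin k → V) := moduleTopology ℂ (Fin k → V)
  have : IsModuleTopology ℂ (Fin k → V) := ⟨rfl⟩
  have := IsModuleTopology.toContinuousAdd ℂ (Fin k → V)
  exact (IsModuleTopology.continuous_of_linearMap φ).comp continuous_induced_dom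

theorem isOpen_gr_exists_ne_zero {k : ℕ} (φ : V →ₗ[ℂ] ℂ) :
    IsOpen {W : Gr V k | ∃ w ∈ W.1, φ w ≠ 0} := by
  have h : (Frame.span ⁻¹' {W : Gr V k | ∃ w ∈ W.1, φ w ≠ 0}) =
      ⋃ i, {v : Frame V k | (φ ∘ₗ LinearMap.proj i) v.1 ≠ 0} := by
    ext v
    simp only [Set.mem_preimage, Set.mem_ofPred_eq, Set.mem_iUnion, LinearMap.comp_apply,
      LinearMap.proj_apply]
    constructor
    · rintro ⟨w, hw, hne⟩
      by_contra! H
      have : Submodule.span ℂ (Set.range v.1) ≤ LinearMap.ker φ := by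
        rw [Submodule.span_le]
        rintro _ ⟨i, rfl⟩
        exact H i
      exact hne (this hw)
    · rintro ⟨i, hi⟩
      exact ⟨v.1 i, Submodule.subset_span ⟨i, rfl⟩, hi⟩
  rw [isOpen_gr_iff, h]
  exact isOpen_iUnion fun i => isOpen_ne.preimage (continuous_frame_linear _)

/-- Transversality to `ker π` is open: on frames it is the nonvanishing of the determinant of `π` in
the given frame. -/
theorem isOpen_gr_injOn {k : ℕ} {U : Type*} [AddCommGroup U] [Module ℂ U]
    [FiniteDimensional ℂ U] (hU : finrank ℂ U = k) (π : V →ₗ[ℂ] U) :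
    IsOpen {W : Gr V k | ∀ w ∈ W.1, π w = 0 → w = 0} := by
  let b := finBasisOfFinrankEq ℂ U hU
  have h : (Frame.span ⁻¹' {W : Gr V k | ∀ w ∈ W.1, π w = 0 → w = 0}) =
      {v : Frame V k | (Matrix.of fun i j => (b.coord i ∘ₗ π ∘ₗ LinearMap.proj j) v.1).det ≠ 0} := by
    ext v
    have h1 : (Matrix.of fun i j => (b.coord i ∘ₗ π ∘ₗ LinearMap.proj j) v.1) =
        b.toMatrix (π ∘ v.1) := by
      ext i j; simp [Basis.toMatrix_apply]
    simp only [Set.mem_preimage, Set.mem_ofPred_eq, h1, ← Basis.det_apply, ← isUnit_iff_ne_zero]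
    rw [← Basis.is_basis_iff_det]
    have h2 : (∀ w ∈ (Frame.span v).1, π w = 0 → w = 0) ↔ LinearIndependent ℂ (π ∘ v.1) := by
      rw [← LinearMap.disjoint_ker]
      exact ⟨fun H => v.2.map H, fun H => Submodule.range_ker_disjoint H⟩
    rw [h2]
    refine ⟨fun H => ⟨H, H.span_eq_top_of_card_eq_finrank' (by simp [hU])⟩, fun H => H.1⟩
  rw [isOpen_gr_iff, h]
  refine isOpen_ne.preimage (Continuous.matrix_det ?_)
  exact continuous_matrix fun i j =>
    continuous_frame_linear (b.coord i ∘ₗ π ∘ₗ LinearMap.proj j)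

theorem continuous_frame_line {k : ℕ} (u v : Fin k → V)
    (h : ∀ t : ℂ, LinearIndependent ℂ (u + t • v)) :
    Continuous (Y := Frame V k) fun t : ℂ => ⟨u + t • v, h t⟩ := by
  let _ : TopologicalSpace (Fin k → V) := moduleTopology ℂ (Fin k → V)
  have : IsModuleTopology ℂ (Fin k → V) := ⟨rfl⟩
  have := IsModuleTopology.toContinuousAdd ℂ (Fin k → V)
  have := IsModuleTopology.toContinuousSMul ℂ (Fin k → V)
  refine continuous_induced_rng.2 ?_
  change Continuous fun t : ℂ => u + t • v
  fun_prop

end Topology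

/-! ### Isotropic planes and their deformation by unipotent isometries -/

variable {E : Type*} [AddCommGroup E] [Module ℂ E]

theorem QuadricPlane.isotropic (P : QuadricPlane E) {v : E × Dual ℂ E} (hv : v ∈ P.1.1) :
    v.2 v.1 = 0 :=
  (isotropic_iff _).1 P.2 v hv

theorem QuadricPlane.isotropic₂ (P : QuadricPlane E) {v w : E × Dual ℂ E} (hv : v ∈ P.1.1)
    (hw : w ∈ P.1.1) : v.2 w.1 + w.2 v.1 = 0 := by
  have h := P.isotropic (add_mem hv hw)
  simp only [Prod.fst_add, Prod.snd_add, map_add, LinearMap.add_apply, P.isotropic hv,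
    P.isotropic hw] at h
  linear_combination h

theorem continuous_planeVal : Continuous (Subtype.val : QuadricPlane E → Gr (E × Dual ℂ E) 3) :=
  continuous_induced_dom

theorem QuadricPlane.ext {P Q : QuadricPlane E} (h : P.1.1 = Q.1.1) : P = Q :=
  Subtype.ext (Subtype.ext h)

/-- A one-parameter family `1 + t N` of isometries moves a plane within its component. -/
theorem connectedComponent_eq_of_map (N : Module.End ℂ (E × Dual ℂ E))
    (hinj : ∀ (t : ℂ) v, v + t • N v = 0 → v = 0)
    (hiso : ∀ (t : ℂ) v, (v + t • N v).2 (v + t • N v).1 = v.2 v.1)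
    {P Q : QuadricPlane E} (hPQ : Q.1.1 = P.1.1.map (LinearMap.id + N)) :
    connectedComponent P = connectedComponent Q := by
  have : FiniteDimensional ℂ P.1.1 := FiniteDimensional.of_finrank_pos (by have := P.1.2; omega)
  let b := finBasisOfFinrankEq ℂ P.1.1 P.1.2
  let u : Fin 3 → E × Dual ℂ E := fun i => b i
  have hu : LinearIndependent ℂ u := b.linearIndependent.map' P.1.1.subtype (by simp)
  have hspan : Submodule.span ℂ (Set.range u) = P.1.1 := by
    have := congrArg (Submodule.map P.1.1.subtype) b.span_eq
    rw [Submodule.map_span, ← Set.range_comp, Submodule.map_subtype_top] at this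
    exact this
  have hcomp : ∀ t : ℂ, u + t • (N ∘ u) = (LinearMap.id + t • N : Module.End ℂ (E × Dual ℂ E)) ∘ u :=
    fun t => rfl
  have hli : ∀ t : ℂ, LinearIndependent ℂ (u + t • (N ∘ u)) := fun t => by
    rw [hcomp]; exact hu.map' _ (LinearMap.ker_eq_bot'.2 (hinj t))
  have hsp : ∀ t : ℂ, (Frame.span ⟨_, hli t⟩).1 = P.1.1.map (LinearMap.id + t • N) := fun t => by
    change Submodule.span ℂ (Set.range (u + t • (N ∘ u))) = _
    rw [hcomp, Set.range_comp, ← Submodule.map_span, hspan]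
  -- A continuous image of the connected space `ℂ`, joining `P` at `t = 0` to `Q` at `t = 1`.
  let γ : ℂ → QuadricPlane E := fun t => ⟨Frame.span ⟨_, hli t⟩, by
    rw [isotropic_iff, hsp]
    rintro _ ⟨v, hv, rfl⟩
    refine (hiso t v).trans ?_
    exact P.isotropic hv⟩
  have hγ : Continuous γ := by
    refine continuous_induced_rng.2 ?_
    exact (continuous_coinduced_rng : Continuous (Frame.span (V := E × Dual ℂ E) (k := 3))).comp
      (continuous_frame_line u (N ∘ u) hli)
  have h0 : γ 0 = P := QuadricPlane.ext (by
    change (Frame.span ⟨_, hli 0⟩).1 = _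
    rw [hsp, zero_smul, add_zero]; exact Submodule.map_id _)
  have h1 : γ 1 = Q := QuadricPlane.ext (by
    change (Frame.span ⟨_, hli 1⟩).1 = _
    rw [hsp, one_smul, hPQ])
  have := (isPreconnected_range hγ).subset_connectedComponent (Set.mem_range_self 0)
    (Set.mem_range_self 1)
  rw [h0, h1] at this
  exact connectedComponent_eq this

/-! ### Alternating maps between `E` and `E*` -/

/-- Up to a nonzero scalar, `ι_α β` is a cross product of `α` and `β`; the algebraic identities
below are read off from this. -/
theorem interiorDual_coord (hE : finrank ℂ E = 3) {ω : E [⋀^Fin 3]→ₗ[ℂ] ℂ} (hω : ω ≠ 0) :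
    ∃ b : Basis (Fin 3) ℂ E, ∃ c : ℂ, c ≠ 0 ∧ ∀ α β, interiorDual hE hω α β =
      c • ((α (b 2) * β (b 1) - α (b 1) * β (b 2)) • b 0 +
        (α (b 0) * β (b 2) - α (b 2) * β (b 0)) • b 1 +
        (α (b 1) * β (b 0) - α (b 0) * β (b 1)) • b 2) := by
  obtain ⟨b, c, hc, rfl⟩ := exists_basis hE hω
  refine ⟨b, c⁻¹, inv_ne_zero hc, fun α β => ?_⟩
  have h : (wedgeEquivDual hE hω).symm β =
      c⁻¹ • (β (b 0) • exteriorPower.ιMulti ℂ 2 ![b 1, b 2]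
        + β (b 1) • exteriorPower.ιMulti ℂ 2 ![b 2, b 0]
        + β (b 2) • exteriorPower.ιMulti ℂ 2 ![b 0, b 1]) := by
    rw [LinearEquiv.symm_apply_eq]
    change β = wedgeToDual _ _
    refine b.ext fun i => ?_
    simp only [map_smul, map_add, LinearMap.smul_apply, LinearMap.add_apply, wedgeToDual_wedge,
      AlternatingMap.smul_apply, Basis.det_apply, Matrix.det_fin_three, Basis.toMatrix_apply]
    fin_cases i <;> simp <;> field_simp
  change interior α ((wedgeEquivDual hE hω).symm β) = _
  simp only [h, map_smul, map_add, interior_wedge]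
  module

theorem interiorDual_swap (hE : finrank ℂ E = 3) {ω : E [⋀^Fin 3]→ₗ[ℂ] ℂ} (hω : ω ≠ 0)
    (α β : Dual ℂ E) : interiorDual hE hω α β = -interiorDual hE hω β α := by
  obtain ⟨b, c, -, h⟩ := interiorDual_coord hE hω
  rw [h, h]
  module

theorem interiorDual_self (hE : finrank ℂ E = 3) {ω : E [⋀^Fin 3]→ₗ[ℂ] ℂ} (hω : ω ≠ 0)
    (α : Dual ℂ E) : interiorDual hE hω α α = 0 := by
  obtain ⟨b, c, -, h⟩ := interiorDual_coord hE hω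
  rw [h]
  module

theorem apply_interiorDual_left (hE : finrank ℂ E = 3) {ω : E [⋀^Fin 3]→ₗ[ℂ] ℂ} (hω : ω ≠ 0)
    (α β : Dual ℂ E) : α (interiorDual hE hω α β) = 0 := by
  rw [interiorDual_swap, map_neg, apply_interiorDual_self, neg_zero]

/-- The coordinates of `ι_α β` are the 2×2 minors of the pair `(α, β)`, so their vanishing means
proportionality. -/
theorem smul_eq_smul_of_interiorDual_eq_zero (hE : finrank ℂ E = 3)
    {ω : E [⋀^Fin 3]→ₗ[ℂ] ℂ} (hω : ω ≠ 0) {α β : Dual ℂ E} (h0 : interiorDual hE hω α β = 0)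
    (x : E) : α x • β = β x • α := by
  obtain ⟨b, c, hc, h⟩ := interiorDual_coord hE hω
  rw [h, smul_eq_zero_iff_right hc] at h0
  have hr := fun i => congrArg (fun v => b.repr v i) h0
  have h1 := hr 0
  have h2 := hr 1
  have h3 := hr 2
  simp at h1 h2 h3
  suffices H : ∀ i j, α (b i) * β (b j) = β (b i) * α (b j) by
    refine b.ext fun j => ?_
    have : α.smulRight (β (b j)) = β.smulRight (α (b j)) := b.ext fun i => by simpa using H i j
    simpa using congrArg (fun f => f x) this
  intro i j
  fin_cases i <;> fin_cases j <;> simp only [Fin.zero_eta, Fin.mk_one, Fin.reduceFinMk] <;>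
    first | ring1 | linear_combination h1 | linear_combination -h1 | linear_combination h2 |
      linear_combination -h2 | linear_combination h3 | linear_combination -h3

/-- Every alternating map `E* → E` is the interior product with a linear form. -/
theorem exists_interiorDual_eq (hE : finrank ℂ E = 3) {ω : E [⋀^Fin 3]→ₗ[ℂ] ℂ} (hω : ω ≠ 0)
    (T : Dual ℂ E →ₗ[ℂ] E) (hT : ∀ f : Dual ℂ E, f (T f) = 0) : ∃ α, interiorDual hE hω α = T := by
  obtain ⟨b, c, hc, h⟩ := interiorDual_coord hE hω
  have hT2 : ∀ f g : Dual ℂ E, f (T g) + g (T f) = 0 := fun f g => by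
    have := hT (f + g)
    simp only [map_add, LinearMap.add_apply, hT] at this
    linear_combination this
  -- The matrix of `T` is skew, so it has three free entries; comparing them with those of `ι_α`
  -- gives the coordinates of `α`.
  refine ⟨c⁻¹ • (b.coord 2 (T (b.coord 0)) • b.coord 1 - b.coord 1 (T (b.coord 0)) • b.coord 2 -
    b.coord 2 (T (b.coord 1)) • b.coord 0), b.dualBasis.ext fun i => b.ext_elem fun j => ?_⟩
  have h00 := hT (b.coord 0)
  have h11 := hT (b.coord 1)
  have h22 := hT (b.coord 2)
  have h01 := hT2 (b.coord 0) (b.coord 1)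
  have h02 := hT2 (b.coord 0) (b.coord 2)
  have h12 := hT2 (b.coord 1) (b.coord 2)
  simp only [Basis.coord_apply] at h00 h11 h22 h01 h02 h12
  rw [h]
  fin_cases i <;> fin_cases j <;> simp <;> (try field_simp) <;>
    first | linear_combination h00 | linear_combination -h00 | linear_combination -h11 |
      linear_combination -h22 | linear_combination h01 | linear_combination h02 |
      linear_combination h12 | linear_combination -h01 | linear_combination -h02 |
      linear_combination -h12

/-- Take `T = φ ∧ ψ` with `φ, ψ` a basis of the annihilator of `x`: its kernel is their common zero
locus. -/
theorem exists_alternating_ker (hE : finrank ℂ E = 3) {x : E} (hx : x ≠ 0) :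
    ∃ T : E →ₗ[ℂ] Dual ℂ E, (∀ e, T e e = 0) ∧ ∀ e, T e = 0 ↔ e ∈ Submodule.span ℂ {x} := by
  have : FiniteDimensional ℂ E := FiniteDimensional.of_finrank_pos (by omega)
  let K := Submodule.span ℂ {x}
  have hK : finrank ℂ K = 1 := finrank_span_singleton hx
  have hK' : finrank ℂ K.dualAnnihilator = 2 := by
    have := Subspace.finrank_add_finrank_dualAnnihilator_eq K
    omega
  let b := finBasisOfFinrankEq ℂ K.dualAnnihilator hK'
  have hb : LinearIndependent ℂ fun i => (b i : Dual ℂ E) :=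
    b.linearIndependent.map' K.dualAnnihilator.subtype (by simp)
  let φ : Dual ℂ E := b 0
  let ψ : Dual ℂ E := b 1
  refine ⟨φ.smulRight ψ - ψ.smulRight φ, fun e => by simp [mul_comm], fun e => ?_⟩
  have key : (φ e = 0 ∧ ψ e = 0) ↔ e ∈ K := by
    rw [← Subspace.dualAnnihilator_dualCoannihilator_eq (W := K),
      Submodule.mem_dualCoannihilator]
    constructor
    · rintro ⟨h0, h1⟩ f hf
      have := congrArg (fun g : K.dualAnnihilator => (g : Dual ℂ E) e) (b.sum_repr ⟨f, hf⟩)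
      simp only [Fin.sum_univ_two] at this
      change _ * φ e + _ * ψ e = f e at this
      rw [← this, h0, h1]; ring
    · intro H
      exact ⟨H _ (b 0).2, H _ (b 1).2⟩
  rw [← key]
  constructor
  · intro h
    have h' : (-ψ e) • φ + φ e • ψ = 0 := by
      rw [← h]
      simp only [LinearMap.sub_apply, LinearMap.smulRight_apply]
      module
    have hb' : LinearIndependent ℂ ![φ, ψ] := by
      convert hb using 1
      ext i
      fin_cases i <;> rfl
    have := LinearIndependent.pair_iff.1 hb' _ _ h'
    exact ⟨this.2, neg_eq_zero.1 this.1⟩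
  · rintro ⟨h0, h1⟩
    simp [h0, h1]

/-! ### Split planes and the intersection with `E` -/

theorem finiteDimensional_of_finrank_eq_three (hE : finrank ℂ E = 3) : FiniteDimensional ℂ E :=
  FiniteDimensional.of_finrank_pos (by omega)

/-- The plane `ℙ(K ⊕ K^⊥)` attached to a subspace `K` of `E`. -/
def splitPlane (hE : finrank ℂ E = 3) (K : Submodule ℂ E) : QuadricPlane E :=
  ⟨⟨K.prod K.dualAnnihilator, by
    have := finiteDimensional_of_finrank_eq_three hE
    have h1 := Subspace.finrank_add_finrank_dualAnnihilator_eq K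
    have h2 : LinearMap.range (K.subtype.prodMap K.dualAnnihilator.subtype) =
        K.prod K.dualAnnihilator := by
      rw [LinearMap.range_prodMap, Submodule.range_subtype, Submodule.range_subtype]
    rw [← h2, LinearMap.finrank_range_of_inj
      (Function.Injective.prodMap (Subtype.val_injective) (Subtype.val_injective)),
      finrank_prod, h1, hE]⟩, by
    rw [isotropic_iff]
    rintro v ⟨h1, h2⟩
    exact (Submodule.mem_dualAnnihilator _).1 h2 _ h1⟩

theorem mem_splitPlane {hE : finrank ℂ E = 3} {K : Submodule ℂ E} {v : E × Dual ℂ E} :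
    v ∈ (splitPlane hE K).1.1 ↔ v.1 ∈ K ∧ v.2 ∈ K.dualAnnihilator :=
  Iff.rfl

/-- The intersection of (the linear space of) a plane with `E`. -/
def QuadricPlane.inter (P : QuadricPlane E) : Submodule ℂ E :=
  P.1.1.comap (LinearMap.inl ℂ E (Dual ℂ E))

theorem QuadricPlane.mem_inter {P : QuadricPlane E} {e : E} : e ∈ P.inter ↔ (e, 0) ∈ P.1.1 :=
  Iff.rfl

@[simp]
theorem inter_splitPlane (hE : finrank ℂ E = 3) (K : Submodule ℂ E) :
    (splitPlane hE K).inter = K := by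
  ext e
  simp [QuadricPlane.mem_inter, mem_splitPlane]

/-- Pairing with `W ∩ E` gives one inclusion. Equality follows by rank–nullity, since the kernel of
the projection on `W` is `W ∩ E`. -/
theorem QuadricPlane.map_snd (hE : finrank ℂ E = 3) (P : QuadricPlane E) :
    P.1.1.map (LinearMap.snd ℂ E (Dual ℂ E)) = P.inter.dualAnnihilator := by
  have := finiteDimensional_of_finrank_eq_three hE
  have hle : P.1.1.map (LinearMap.snd ℂ E (Dual ℂ E)) ≤ P.inter.dualAnnihilator := by
    rintro _ ⟨v, hv, rfl⟩
    rw [Submodule.mem_dualAnnihilator]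
    intro e he
    simpa using P.isotropic₂ hv (QuadricPlane.mem_inter.1 he)
  refine Submodule.eq_of_le_of_finrank_eq hle ?_
  have h1 := Subspace.finrank_add_finrank_dualAnnihilator_eq P.inter
  have h2 := ((LinearMap.snd ℂ E (Dual ℂ E)).domRestrict P.1.1).finrank_range_add_finrank_ker
  have h3 : finrank ℂ (LinearMap.ker ((LinearMap.snd ℂ E (Dual ℂ E)).domRestrict P.1.1)) =
      finrank ℂ P.inter := by
    have h : P.inter.map (LinearMap.inl ℂ E (Dual ℂ E)) =
        (LinearMap.ker ((LinearMap.snd ℂ E (Dual ℂ E)).domRestrict P.1.1)).map P.1.1.subtype := by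
      rw [QuadricPlane.inter, Submodule.map_comap_eq, LinearMap.range_inl, inf_comm,
        ← Submodule.map_comap_subtype]
      rfl
    rw [← Submodule.finrank_map_subtype_eq P.1.1, ← h]
    exact (Submodule.equivMapOfInjective (LinearMap.inl ℂ E (Dual ℂ E)) LinearMap.inl_injective
      P.inter).finrank_eq.symm
  have h4 := P.1.2
  rw [LinearMap.range_domRestrict] at h2
  omega

/-! ### Normal form of a plane and classification of the orbits -/

/-- A linear form as an element of `SL(E) ⋉ E*`. -/
def shear (α : Dual ℂ E) : SLDual E := ⟨Multiplicative.ofAdd α, 1⟩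

theorem rep_apply (hE : finrank ℂ E = 3) {ω : E [⋀^Fin 3]→ₗ[ℂ] ℂ} (hω : ω ≠ 0)
    (h : SLDual E) (v : E × Dual ℂ E) : rep hE hω h v =
    (h.right.1 v.1 + interiorDual hE hω h.left.toAdd (h.right.1.symm.dualMap v.2),
      h.right.1.symm.dualMap v.2) :=
  rfl

theorem rep_shear (hE : finrank ℂ E = 3) {ω : E [⋀^Fin 3]→ₗ[ℂ] ℂ} (hω : ω ≠ 0)
    (α : Dual ℂ E) (v : E × Dual ℂ E) :
    rep hE hω (shear α) v = (v.1 + interiorDual hE hω α v.2, v.2) :=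
  rfl

theorem mem_planeOrbit (hE : finrank ℂ E = 3) {ω : E [⋀^Fin 3]→ₗ[ℂ] ℂ} (hω : ω ≠ 0)
    {P Q : QuadricPlane E} :
    Q ∈ planeOrbit hE hω P ↔ ∃ h, Q.1.1 = P.1.1.map (rep hE hω h) := by
  let _ := planeAction hE hω
  change (∃ h : SLDual E, h • P = Q) ↔ _
  exact exists_congr fun h => ⟨fun H => by rw [← H]; rfl, fun H => QuadricPlane.ext H.symm⟩

theorem finrank_map_rep (hE : finrank ℂ E = 3) {ω : E [⋀^Fin 3]→ₗ[ℂ] ℂ} (hω : ω ≠ 0)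
    (h : SLDual E) (P : QuadricPlane E) :
    finrank ℂ (P.1.1.map (rep hE hω h)) = 3 :=
  (Submodule.equivMapOfInjective _ (rep_injective hE hω h) P.1.1).finrank_eq.symm.trans P.1.2

/-- Every plane in the quadric is of the form `α • ℙ(K ⊕ K^⊥)`. -/
theorem exists_shear_splitPlane (hE : finrank ℂ E = 3) {ω : E [⋀^Fin 3]→ₗ[ℂ] ℂ} (hω : ω ≠ 0)
    (P : QuadricPlane E) :
    ∃ α, P.1.1 = (splitPlane hE P.inter).1.1.map (rep hE hω (shear α)) := by
  have := finiteDimensional_of_finrank_eq_three hE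
  set M := P.inter.dualAnnihilator with hM
  have hmem : ∀ v : P.1.1, (LinearMap.snd ℂ E (Dual ℂ E) ∘ₗ P.1.1.subtype) v ∈ M := fun v => by
    rw [hM, ← P.map_snd hE]
    exact ⟨v, v.2, rfl⟩
  let s : P.1.1 →ₗ[ℂ] M := LinearMap.codRestrict M _ hmem
  have hs : LinearMap.range s = ⊤ := by
    rw [LinearMap.range_eq_top]
    rintro ⟨f, hf⟩
    have hf' := hf
    rw [hM, ← P.map_snd hE] at hf'
    obtain ⟨v, hv, rfl⟩ := hf'
    exact ⟨⟨v, hv⟩, rfl⟩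
  obtain ⟨r, hr⟩ := s.exists_rightInverse_of_surjective hs
  obtain ⟨p, hp⟩ := M.subtype.exists_leftInverse_of_injective (by simp)
  -- `σ` picks a lift `(σ f, f)` in `W` of each `f ∈ K^⊥`.
  let σ : M →ₗ[ℂ] E := LinearMap.fst ℂ E (Dual ℂ E) ∘ₗ P.1.1.subtype ∘ₗ r
  have hσ : ∀ f : M, (σ f, (f : Dual ℂ E)) ∈ P.1.1 := fun f => by
    have h1 : ((r f : E × Dual ℂ E)).2 = f :=
      congrArg Subtype.val (LinearMap.congr_fun hr f)
    rw [← h1]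
    exact (r f).2
  have hp' : ∀ f : M, p f = f := fun f => LinearMap.congr_fun hp f
  -- `T = pᵗ σ p`, with `p` a projection of `E*` onto `K^⊥`. The transpose makes `T` alternating on
  -- all of `E*`; on `K^⊥` it agrees with `σ` only modulo `K`, which suffices.
  let T : Dual ℂ E →ₗ[ℂ] E := (evalEquiv ℂ E).symm.toLinearMap ∘ₗ
    (M.subtype ∘ₗ p).dualMap ∘ₗ Dual.eval ℂ E ∘ₗ σ ∘ₗ p
  have hT : ∀ f g : Dual ℂ E, g (T f) = (p g : Dual ℂ E) (σ (p f)) := fun f g => by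
    change g ((evalEquiv ℂ E).symm _) = _
    rw [apply_evalEquiv_symm_apply]
    rfl
  obtain ⟨α, hα⟩ := exists_interiorDual_eq hE hω T fun f => by
    rw [hT]
    exact P.isotropic (hσ (p f))
  refine ⟨α, (Submodule.eq_of_le_of_finrank_eq ?_ ?_).symm⟩
  · rintro _ ⟨⟨e, f⟩, ⟨he, hf⟩, rfl⟩
    have hk : T f - σ ⟨f, hf⟩ ∈ P.inter := by
      rw [← Subspace.dualAnnihilator_dualCoannihilator_eq (W := P.inter),
        Submodule.mem_dualCoannihilator]
      intro g hg
      have h1 := hp' ⟨f, hf⟩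
      have h2 := hp' ⟨g, hg⟩
      simp only at h1 h2
      rw [map_sub, hT, h1, h2, sub_self]
    have := add_mem (QuadricPlane.mem_inter.1 (add_mem he hk)) (hσ ⟨f, hf⟩)
    rw [rep_shear, hα]
    convert this using 1
    ext1
    · simp only [Prod.fst_add]
      abel
    · simp
  · exact (finrank_map_rep hE hω _ _).trans P.1.2.symm

/-- The group preserves `E`, and `(α, g)` acts on it through `g` alone. -/
theorem finrank_inter_of_map (hE : finrank ℂ E = 3) {ω : E [⋀^Fin 3]→ₗ[ℂ] ℂ} (hω : ω ≠ 0)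
    {P Q : QuadricPlane E} {h : SLDual E}
    (H : Q.1.1 = P.1.1.map (rep hE hω h)) : finrank ℂ Q.inter = finrank ℂ P.inter := by
  have : Q.inter = P.inter.map h.right.1.toLinearMap := by
    ext e
    rw [QuadricPlane.mem_inter, H]
    constructor
    · rintro ⟨⟨x, f⟩, hv, hx⟩
      rw [rep_apply, Prod.mk.injEq] at hx
      have hf : f = 0 := by
        have := hx.2
        simpa using this
      subst hf
      exact ⟨x, hv, by simpa using hx.1⟩
    · rintro ⟨x, hx, rfl⟩
      exact ⟨(x, 0), hx, by rw [rep_apply]; simp⟩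
  rw [this, LinearEquiv.finrank_map_eq]

theorem exists_specialLinearGroup_map_eq (hE : finrank ℂ E = 3) {K L : Submodule ℂ E}
    (hKL : finrank ℂ K = finrank ℂ L) :
    ∃ g : SpecialLinearGroup ℂ E, K.map g.1.toLinearMap = L := by
  have := finiteDimensional_of_finrank_eq_three hE
  obtain ⟨g, hg⟩ := Submodule.exists_linearEquiv_restrict_eq (LinearEquiv.ofFinrankEq K L hKL)
  have hgK : K.map g.toLinearMap = L := by
    refine Submodule.eq_of_le_of_finrank_eq ?_ ?_
    · rintro _ ⟨x, hx, rfl⟩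
      have := hg ⟨x, hx⟩
      change g x ∈ L
      rw [← this]
      exact Subtype.property _
    · rw [← hKL]
      exact LinearEquiv.finrank_map_eq g K
  have hdet : LinearMap.det g.toLinearMap ≠ 0 := g.isUnit_det'.ne_zero
  -- Scaling by a cube root of `det⁻¹` makes the determinant 1 and leaves the image of `K`
  -- unchanged.
  obtain ⟨c, hc⟩ := IsAlgClosed.exists_pow_nat_eq (LinearMap.det g.toLinearMap)⁻¹
    (n := 3) (by norm_num)
  have hc0 : c ≠ 0 := by
    rintro rfl
    rw [zero_pow (by norm_num)] at hc
    exact inv_ne_zero hdet hc.symm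
  let g' : E ≃ₗ[ℂ] E := g.trans (LinearEquiv.smulOfNeZero ℂ E c hc0)
  have hg' : g'.toLinearMap = c • g.toLinearMap := by
    ext x; rfl
  refine ⟨⟨g', ?_⟩, ?_⟩
  · rw [← Units.val_inj, LinearEquiv.coe_det, hg', LinearMap.det_smul, hE, hc]
    simp [hdet]
  · rw [hg', Submodule.map_smul _ _ _ hc0, hgK]

theorem planeOrbit_eq (hE : finrank ℂ E = 3) {ω : E [⋀^Fin 3]→ₗ[ℂ] ℂ} (hω : ω ≠ 0)
    (P : QuadricPlane E) :
    planeOrbit hE hω P = {Q | finrank ℂ Q.inter = finrank ℂ P.inter} := by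
  have := finiteDimensional_of_finrank_eq_three hE
  ext Q
  rw [mem_planeOrbit]
  refine ⟨fun ⟨h, H⟩ => finrank_inter_of_map hE hω H, fun H => ?_⟩
  obtain ⟨g, hg⟩ := exists_specialLinearGroup_map_eq hE (Eq.symm H)
  obtain ⟨α, hα⟩ := exists_shear_splitPlane hE hω P
  obtain ⟨β, hβ⟩ := exists_shear_splitPlane hE hω Q
  have hG : (splitPlane hE Q.inter).1.1 =
      (splitPlane hE P.inter).1.1.map (rep hE hω ⟨1, g⟩) := by
    refine (Submodule.eq_of_le_of_finrank_eq ?_ ?_).symm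
    · rintro _ ⟨⟨e, f⟩, ⟨he, hf⟩, rfl⟩
      rw [rep_apply, mem_splitPlane]
      simp only [toAdd_one, interiorDual_zero, LinearMap.zero_apply, add_zero]
      refine ⟨hg ▸ ⟨e, he, rfl⟩, ?_⟩
      rw [Submodule.mem_dualAnnihilator, ← hg]
      rintro _ ⟨x, hx, rfl⟩
      simpa using (Submodule.mem_dualAnnihilator _).1 hf x hx
    · exact (finrank_map_rep hE hω _ _).trans (splitPlane hE Q.inter).1.2.symm
  -- Undo the shear of `P`, match the split planes by `g`, then apply the shear of `Q`.
  refine ⟨shear β * ⟨1, g⟩ * (shear α)⁻¹, ?_⟩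
  have hα' : P.1.1.map (rep hE hω (shear α)⁻¹) = (splitPlane hE P.inter).1.1 := by
    rw [hα, ← Submodule.map_comp]
    change Submodule.map (rep hE hω (shear α)⁻¹ * rep hE hω (shear α)) _ = _
    rw [← map_mul, inv_mul_cancel, map_one]
    exact Submodule.map_id _
  rw [map_mul, map_mul, Module.End.mul_eq_comp, Module.End.mul_eq_comp, Submodule.map_comp,
    Submodule.map_comp, hα', ← hG]
  exact hβ

/-! ### The parity of `dim (W ∩ E)` is locally constant -/

theorem exists_mem_iff (hE : finrank ℂ E = 3) {ω : E [⋀^Fin 3]→ₗ[ℂ] ℂ} (hω : ω ≠ 0)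
    (P : QuadricPlane E) : ∃ α, ∀ v, v ∈ P.1.1 ↔
      v.1 - interiorDual hE hω α v.2 ∈ P.inter ∧ v.2 ∈ P.inter.dualAnnihilator := by
  obtain ⟨α, hα⟩ := exists_shear_splitPlane hE hω P
  refine ⟨α, fun v => ?_⟩
  rw [hα]
  constructor
  · rintro ⟨w, ⟨h1, h2⟩, rfl⟩
    rw [rep_shear]
    exact ⟨by simpa using h1, h2⟩
  · intro h
    exact ⟨(v.1 - interiorDual hE hω α v.2, v.2), h, by rw [rep_shear]; simp⟩

/-- The annihilator of `S` is a line, spanned by `f`, so `S = ker f`. -/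
theorem mem_of_apply_eq_zero (hE : finrank ℂ E = 3) {S : Submodule ℂ E} (hS : finrank ℂ S = 2)
    {f : Dual ℂ E} (hf : f ∈ S.dualAnnihilator) (hf0 : f ≠ 0) {y : E} (hy : f y = 0) : y ∈ S := by
  have := finiteDimensional_of_finrank_eq_three hE
  have h1 : finrank ℂ S.dualAnnihilator = 1 := by
    have := Subspace.finrank_add_finrank_dualAnnihilator_eq S
    omega
  rw [← Subspace.dualAnnihilator_dualCoannihilator_eq (W := S), Submodule.mem_dualCoannihilator]
  intro g hg
  obtain ⟨c, hc⟩ := (finrank_eq_one_iff_of_nonzero' (⟨f, hf⟩ : S.dualAnnihilator)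
    (by simpa using hf0)).1 h1 ⟨g, hg⟩
  have hc' : c • f = g := congrArg Subtype.val hc
  rw [← hc', LinearMap.smul_apply, hy, smul_zero]

theorem exists_mem_dualAnnihilator_ne_zero (hE : finrank ℂ E = 3) {S : Submodule ℂ E}
    (hS : finrank ℂ S ≠ 3) : ∃ f ∈ S.dualAnnihilator, f ≠ 0 := by
  have := finiteDimensional_of_finrank_eq_three hE
  refine (Submodule.ne_bot_iff _).1 fun h => hS ?_
  have := Subspace.finrank_add_finrank_dualAnnihilator_eq S
  rw [h, finrank_bot] at this
  omega

theorem finrank_inter_le (hE : finrank ℂ E = 3) (P : QuadricPlane E) :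
    finrank ℂ P.inter ≤ 3 := by
  have := finiteDimensional_of_finrank_eq_three hE
  exact (Submodule.finrank_le _).trans hE.le

/-- For even `d` some nonzero `(0, f)` lies in `W`. If `d = 0`, take `f = α`, or any `f` when `α =
0`. If `d = 2`, take `f` spanning `K^⊥`: then `f (ι_α f) = 0` forces `ι_α f ∈ K`. -/
theorem odd_finrank_inter (hE : finrank ℂ E = 3) {ω : E [⋀^Fin 3]→ₗ[ℂ] ℂ} (hω : ω ≠ 0)
    {P : QuadricPlane E} (h : ∀ v ∈ P.1.1, v.1 = 0 → v = 0) : Odd (finrank ℂ P.inter) := by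
  have := finiteDimensional_of_finrank_eq_three hE
  obtain ⟨α, hα⟩ := exists_mem_iff hE hω P
  have hle := finrank_inter_le hE P
  have key : ∀ f ∈ P.inter.dualAnnihilator, f ≠ 0 → interiorDual hE hω α f ∉ P.inter := by
    intro f hf hf0 hm
    have := h (0, f) ((hα _).2 ⟨by simpa using hm, hf⟩) rfl
    exact hf0 (congrArg Prod.snd this)
  obtain h0 | h2 | h13 : finrank ℂ P.inter = 0 ∨ finrank ℂ P.inter = 2 ∨
      finrank ℂ P.inter = 1 ∨ finrank ℂ P.inter = 3 := by omega
  · have hbot : P.inter = ⊥ := Submodule.finrank_eq_zero.1 h0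
    rw [hbot, Submodule.dualAnnihilator_bot] at key
    by_cases hα0 : α = 0
    · obtain ⟨f, -, hf⟩ := exists_mem_dualAnnihilator_ne_zero hE (S := P.inter) (by omega)
      exact absurd (by simp [hα0, interiorDual_zero]) (key f trivial hf)
    · exact absurd (by simp [interiorDual_self]) (key α trivial hα0)
  · obtain ⟨f, hf, hf0⟩ := exists_mem_dualAnnihilator_ne_zero hE (S := P.inter) (by omega)
    exact absurd (mem_of_apply_eq_zero hE h2 hf hf0 (apply_interiorDual_self hE hω α f))
      (key f hf hf0)
  · obtain h | h := h13 <;> rw [h] <;> decide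

/-- The hypothesis is transversality to the split plane of the line spanned by `x`, so `x ∉ K`,
excluding `d = 3`. If `d = 1`, a nonzero `f` annihilating `K + ⟨x⟩` has `ι_α f` in that sum, and the
`x`-component `y` of `ι_α f` gives a common vector `(y, f)`. -/
theorem even_finrank_inter (hE : finrank ℂ E = 3) {ω : E [⋀^Fin 3]→ₗ[ℂ] ℂ} (hω : ω ≠ 0)
    {P : QuadricPlane E} {x : E} (hx : x ≠ 0)
    (h : ∀ v ∈ P.1.1, v.1 ∈ Submodule.span ℂ {x} → v.2 x = 0 → v = 0) :
    Even (finrank ℂ P.inter) := by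
  have := finiteDimensional_of_finrank_eq_three hE
  obtain ⟨α, hα⟩ := exists_mem_iff hE hω P
  have hle := finrank_inter_le hE P
  have hxP : x ∉ P.inter := fun hm =>
    hx (congrArg Prod.fst (h (x, 0) hm (Submodule.mem_span_singleton_self x) rfl))
  obtain h1 | h3 | h02 : finrank ℂ P.inter = 1 ∨ finrank ℂ P.inter = 3 ∨
      finrank ℂ P.inter = 0 ∨ finrank ℂ P.inter = 2 := by omega
  · have hS : finrank ℂ (P.inter ⊔ Submodule.span ℂ {x} : Submodule ℂ E) = 2 := by
      have h2 := Submodule.finrank_sup_add_finrank_inf_eq P.inter (Submodule.span ℂ {x})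
      have h3 : P.inter ⊓ Submodule.span ℂ {x} = ⊥ := by
        rw [← disjoint_iff, Submodule.disjoint_span_singleton' hx]
        exact hxP
      rw [h3, finrank_bot, h1, finrank_span_singleton hx] at h2
      exact h2
    obtain ⟨f, hf, hf0⟩ := exists_mem_dualAnnihilator_ne_zero hE
      (S := P.inter ⊔ Submodule.span ℂ {x}) (by omega)
    have hm := mem_of_apply_eq_zero hE hS hf hf0 (apply_interiorDual_self hE hω α f)
    obtain ⟨k, hk, y, hy, hky⟩ := Submodule.mem_sup.1 hm
    have hfK := Submodule.dualAnnihilator_anti (le_sup_left : P.inter ≤ _) hf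
    have hfx := (Submodule.mem_dualAnnihilator _).1 hf x
      (Submodule.mem_sup_right (Submodule.mem_span_singleton_self x))
    have := h (y, f) ((hα _).2 ⟨by simpa [← hky] using hk, hfK⟩) hy hfx
    exact absurd (congrArg Prod.snd this) hf0
  · have : P.inter = ⊤ := Submodule.eq_top_of_finrank_eq (h3.trans hE.symm)
    exact absurd (this ▸ trivial) hxP
  · obtain h | h := h02 <;> rw [h] <;> decide

theorem isOpen_finrank_inter_eq_zero (hE : finrank ℂ E = 3) :
    IsOpen {P : QuadricPlane E | finrank ℂ P.inter = 0} := by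
  have := finiteDimensional_of_finrank_eq_three hE
  have hd : finrank ℂ (Dual ℂ E) = 3 := by rw [Subspace.dual_finrank_eq, hE]
  suffices H : {P : QuadricPlane E | finrank ℂ P.inter = 0} =
      {P : QuadricPlane E | ∀ v ∈ P.1.1, v.2 = 0 → v = 0} by
    rw [H]
    exact (isOpen_gr_injOn hd (LinearMap.snd ℂ E (Dual ℂ E))).preimage continuous_planeVal
  ext P
  rw [Set.mem_ofPred_eq, Set.mem_ofPred_eq, Submodule.finrank_eq_zero, Submodule.eq_bot_iff]
  constructor
  · rintro H ⟨e, f⟩ hv (rfl : f = 0)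
    rw [H e hv]
    rfl
  · intro H e he
    exact congrArg Prod.fst (H (e, 0) he rfl)

theorem isOpen_finrank_inter_ne_three (hE : finrank ℂ E = 3) :
    IsOpen {P : QuadricPlane E | finrank ℂ P.inter ≠ 3} := by
  have := finiteDimensional_of_finrank_eq_three hE
  suffices H : {P : QuadricPlane E | finrank ℂ P.inter ≠ 3} =
      ⋃ e : E, {P : QuadricPlane E | ∃ v ∈ P.1.1, v.2 e ≠ 0} by
    rw [H]
    exact isOpen_iUnion fun e => (isOpen_gr_exists_ne_zero (k := 3)
      (Dual.eval ℂ E e ∘ₗ LinearMap.snd ℂ E (Dual ℂ E))).preimage continuous_planeVal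
  ext P
  simp only [Set.mem_iUnion, Set.mem_ofPred_eq]
  constructor
  -- `d = 3` means that the projection of `W` to `E*` vanishes.
  · intro H
    obtain ⟨f, hf, hf0⟩ := exists_mem_dualAnnihilator_ne_zero hE H
    rw [← P.map_snd hE] at hf
    obtain ⟨v, hv, rfl⟩ := hf
    obtain ⟨e, he⟩ := DFunLike.ne_iff.1 hf0
    exact ⟨e, v, hv, he⟩
  · rintro ⟨e, v, hv, hne⟩ h3
    have hm : v.2 ∈ P.inter.dualAnnihilator := by
      rw [← P.map_snd hE]
      exact ⟨v, hv, rfl⟩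
    rw [Submodule.eq_top_of_finrank_eq (h3.trans hE.symm), Submodule.dualAnnihilator_top] at hm
    rw [Submodule.mem_bot] at hm
    exact hne (by simp [hm])

theorem isOpen_odd (hE : finrank ℂ E = 3) {ω : E [⋀^Fin 3]→ₗ[ℂ] ℂ} (hω : ω ≠ 0) :
    IsOpen {P : QuadricPlane E | Odd (finrank ℂ P.inter)} := by
  have := finiteDimensional_of_finrank_eq_three hE
  rw [isOpen_iff_forall_mem_open]
  intro P hP
  suffices H : ∃ h, ∀ v ∈ P.1.1, (rep hE hω h v).1 = 0 → v = 0 by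
    obtain ⟨h, hh⟩ := H
    refine ⟨_, ?_, (isOpen_gr_injOn hE
      (LinearMap.fst ℂ E (Dual ℂ E) ∘ₗ rep hE hω h)).preimage continuous_planeVal, hh⟩
    intro Q hQ
    let _ := planeAction hE hω
    rw [Set.mem_ofPred_eq, ← finrank_inter_of_map hE hω (Q := h • Q) (h := h) rfl]
    refine odd_finrank_inter hE hω ?_
    rintro _ ⟨v, hv, rfl⟩ h0
    rw [hQ v hv h0, map_zero]
  obtain ⟨α, hα⟩ := exists_mem_iff hE hω P
  have hle := finrank_inter_le hE P
  obtain h1 | h3 : finrank ℂ P.inter = 1 ∨ finrank ℂ P.inter = 3 := by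
    obtain ⟨m, hm⟩ := hP
    omega
  · obtain ⟨⟨k, hk⟩, hk0, hspan⟩ := finrank_eq_one_iff'.1 h1
    have hk0' : k ≠ 0 := fun h => hk0 (Subtype.ext h)
    obtain ⟨β, hβ⟩ : ∃ β : Dual ℂ E, β k ≠ 0 := by
      by_contra! H
      exact hk0' ((Module.forall_dual_apply_eq_zero_iff ℂ k).1 H)
    -- The shear replaces `α` by `β`, so a vector of `W` has new first component `c k + ι_β f`. If
    -- this vanishes, applying `β` gives `c = 0`; then `f` is proportional to `β`, and `f k = 0 ≠ β
    -- k` forces `f = 0`.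
    refine ⟨shear (β - α), fun v hv h0 => ?_⟩
    obtain ⟨he, hf⟩ := (hα v).1 hv
    obtain ⟨c, hc⟩ := hspan ⟨_, he⟩
    have hc' : c • k = v.1 - interiorDual hE hω α v.2 := congrArg Subtype.val hc
    have hadd := interiorDual_add hE hω (β - α) α v.2
    rw [sub_add_cancel] at hadd
    rw [rep_shear] at h0
    have h0' : c • k + interiorDual hE hω β v.2 = 0 := by
      refine Eq.trans ?_ h0
      rw [hc', hadd]
      change _ = v.1 + _
      abel
    have hc0 : c = 0 := by
      have := congrArg β h0'
      rw [map_add, apply_interiorDual_left] at this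
      simpa [hβ] using this
    rw [hc0, zero_smul, zero_add] at h0'
    have hfk := smul_eq_smul_of_interiorDual_eq_zero hE hω h0' k
    rw [(Submodule.mem_dualAnnihilator _).1 hf k hk, zero_smul, smul_eq_zero_iff_right hβ] at hfk
    rw [hc0, zero_smul, hfk, map_zero, sub_zero] at hc'
    exact Prod.ext hc'.symm hfk
  · refine ⟨1, fun v hv h0 => ?_⟩
    have hm := ((hα v).1 hv).2
    rw [Submodule.eq_top_of_finrank_eq (h3.trans hE.symm), Submodule.dualAnnihilator_top,
      Submodule.mem_bot] at hm
    rw [map_one] at h0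
    exact Prod.ext h0 hm

theorem isOpen_even (hE : finrank ℂ E = 3) {ω : E [⋀^Fin 3]→ₗ[ℂ] ℂ} (hω : ω ≠ 0) :
    IsOpen {P : QuadricPlane E | Even (finrank ℂ P.inter)} := by
  have := finiteDimensional_of_finrank_eq_three hE
  rw [isOpen_iff_forall_mem_open]
  intro P hP
  have hle := finrank_inter_le hE P
  obtain h0 | h2 : finrank ℂ P.inter = 0 ∨ finrank ℂ P.inter = 2 := by
    obtain ⟨m, hm⟩ := hP
    omega
  · refine ⟨_, fun Q hQ => ?_, isOpen_finrank_inter_eq_zero hE, h0⟩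
    rw [Set.mem_ofPred_eq] at hQ ⊢
    rw [hQ]
    exact Even.zero
  · obtain ⟨x, hx⟩ : ∃ x, x ∉ P.inter := by
      by_contra! H
      rw [Submodule.eq_top_iff'.2 H, finrank_top] at h2
      omega
    have hx0 : x ≠ 0 := fun h => hx (h ▸ zero_mem _)
    -- Since `x ∉ K`, the plane meets `L` only in 0, and this persists nearby.
    let L := (splitPlane hE (Submodule.span ℂ {x})).1.1
    have hL : finrank ℂ ((E × Dual ℂ E) ⧸ L) = 3 := by
      have h1 := L.finrank_quotient_add_finrank
      have h3 : finrank ℂ L = 3 := (splitPlane hE (Submodule.span ℂ {x})).1.2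
      rw [finrank_prod, Subspace.dual_finrank_eq, hE] at h1
      omega
    have hmem : ∀ v : E × Dual ℂ E, v ∈ L ↔ v.1 ∈ Submodule.span ℂ {x} ∧ v.2 x = 0 := by
      intro v
      rw [mem_splitPlane, Submodule.mem_dualAnnihilator]
      refine and_congr_right fun _ => ⟨fun H => H x (Submodule.mem_span_singleton_self x), ?_⟩
      intro H y hy
      obtain ⟨c, rfl⟩ := Submodule.mem_span_singleton.1 hy
      rw [map_smul, H, smul_zero]
    refine ⟨_, ?_, (isOpen_gr_injOn hL L.mkQ).preimage continuous_planeVal, ?_⟩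
    · intro Q hQ
      refine even_finrank_inter hE hω hx0 fun v hv h1 h2 => hQ v hv ?_
      rw [Submodule.mkQ_apply, Submodule.Quotient.mk_eq_zero]
      exact (hmem v).2 ⟨h1, h2⟩
    · intro v hv h0
      rw [Submodule.mkQ_apply, Submodule.Quotient.mk_eq_zero, hmem] at h0
      have hf : v.2 ∈ P.inter.dualAnnihilator := by
        rw [← P.map_snd hE]
        exact ⟨v, hv, rfl⟩
      have hf0 : v.2 = 0 := by
        by_contra hne
        exact hx (mem_of_apply_eq_zero hE h2 hf hne h0.2)
      obtain ⟨c, hc⟩ := Submodule.mem_span_singleton.1 h0.1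
      have hv1 : v.1 ∈ P.inter := by
        rw [QuadricPlane.mem_inter, ← hf0]
        exact hv
      refine Prod.ext ?_ hf0
      rw [← hc] at hv1 ⊢
      by_contra hne
      exact hx ((Submodule.smul_mem_iff _ fun h => hne (by rw [h, zero_smul]; rfl)).1 hv1)

/-! ### Planes with the same parity lie in one component -/

theorem connectedComponent_eq_splitPlane (hE : finrank ℂ E = 3) {ω : E [⋀^Fin 3]→ₗ[ℂ] ℂ}
    (hω : ω ≠ 0) (P : QuadricPlane E) :
    connectedComponent P = connectedComponent (splitPlane hE P.inter) := by
  obtain ⟨α, hα⟩ := exists_shear_splitPlane hE hω P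
  refine (connectedComponent_eq_of_map
    (LinearMap.inl ℂ E (Dual ℂ E) ∘ₗ interiorDual hE hω α ∘ₗ LinearMap.snd ℂ E (Dual ℂ E))
    ?_ ?_ ?_).symm
  · rintro t ⟨e, f⟩ h
    simp only [LinearMap.comp_apply, LinearMap.inl_apply, LinearMap.snd_apply, Prod.smul_mk,
      Prod.mk_add_mk, smul_zero, add_zero, Prod.mk_eq_zero] at h ⊢
    obtain ⟨h1, rfl⟩ := h
    simpa using h1
  · rintro t ⟨e, f⟩
    simp [apply_interiorDual_self]
  · rw [hα]
    congr 1
    refine LinearMap.ext fun v => ?_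
    rw [rep_shear]
    ext <;> simp

/-- The isometry `(e, f) ↦ (e, f + T e)` does not preserve `E` when `T ≠ 0`, unlike the group
action, so it can change `d` while staying in one component. -/
theorem exists_connectedComponent_eq (P : QuadricPlane E) (T : E →ₗ[ℂ] Dual ℂ E)
    (hT : ∀ e, T e e = 0) : ∃ Q : QuadricPlane E, connectedComponent P = connectedComponent Q ∧
      ∀ e, e ∈ Q.inter ↔ (e, -T e) ∈ P.1.1 := by
  let N := LinearMap.inr ℂ E (Dual ℂ E) ∘ₗ T ∘ₗ LinearMap.fst ℂ E (Dual ℂ E)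
  have hinj : ∀ (t : ℂ) v, v + t • N v = 0 → v = 0 := by
    rintro t ⟨e, f⟩ h
    simp only [N, LinearMap.comp_apply, LinearMap.inr_apply, LinearMap.fst_apply, Prod.smul_mk,
      Prod.mk_add_mk, smul_zero, add_zero, Prod.mk_eq_zero] at h ⊢
    obtain ⟨rfl, h2⟩ := h
    simpa using h2
  have hiso : ∀ (t : ℂ) v, (v + t • N v).2 (v + t • N v).1 = v.2 v.1 := by
    rintro t ⟨e, f⟩
    simp [N, hT]
  have hinj1 : Function.Injective (LinearMap.id + N : Module.End ℂ (E × Dual ℂ E)) :=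
    LinearMap.ker_eq_bot.1 (LinearMap.ker_eq_bot'.2 fun v hv => hinj 1 v (by simpa using hv))
  let Q : QuadricPlane E := ⟨⟨P.1.1.map (LinearMap.id + N),
    (Submodule.equivMapOfInjective _ hinj1 P.1.1).finrank_eq.symm.trans P.1.2⟩, by
      rw [isotropic_iff]
      rintro _ ⟨v, hv, rfl⟩
      have := hiso 1 v
      rw [one_smul] at this
      exact this.trans (P.isotropic hv)⟩
  refine ⟨Q, connectedComponent_eq_of_map N hinj hiso rfl, fun e => ?_⟩
  constructor
  · rintro ⟨⟨x, f⟩, hv, hx⟩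
    have h1 : x = e := by simpa [N] using congrArg Prod.fst hx
    have h2 : f + T x = 0 := by simpa [N] using congrArg Prod.snd hx
    rwa [← h1, ← eq_neg_of_add_eq_zero_left h2]
  · intro h
    exact ⟨_, h, by simp [N]⟩

theorem connectedComponent_eq_of_odd (hE : finrank ℂ E = 3) {ω : E [⋀^Fin 3]→ₗ[ℂ] ℂ}
    (hω : ω ≠ 0) {P : QuadricPlane E} (hP : Odd (finrank ℂ P.inter)) :
    connectedComponent P = connectedComponent (splitPlane hE ⊤) := by
  have := finiteDimensional_of_finrank_eq_three hE
  have hle := finrank_inter_le hE P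
  rw [connectedComponent_eq_splitPlane hE hω P]
  obtain h1 | h3 : finrank ℂ P.inter = 1 ∨ finrank ℂ P.inter = 3 := by
    obtain ⟨m, hm⟩ := hP
    omega
  · obtain ⟨k, hk, hspan⟩ := finrank_eq_one_iff'.1 h1
    have hk0 : (k : E) ≠ 0 := fun h => hk (Subtype.ext h)
    have hK : P.inter = Submodule.span ℂ {(k : E)} := by
      refine (Submodule.eq_of_le_of_finrank_eq ?_ ?_).symm
      · rw [Submodule.span_singleton_le_iff_mem]
        exact k.2
      · rw [finrank_span_singleton hk0, h1]
    obtain ⟨T, hT, hker⟩ := exists_alternating_ker hE hk0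
    -- `E` is moved to the graph of `T`, which meets `E` in `ker T = K`.
    obtain ⟨Q, hQ, hmem⟩ := exists_connectedComponent_eq (splitPlane hE ⊤) T hT
    have hQK : Q.inter = P.inter := by
      ext e
      rw [hmem, mem_splitPlane, hK, ← hker]
      simp
    rw [hQ, connectedComponent_eq_splitPlane hE hω Q, hQK]
  · rw [Submodule.eq_top_of_finrank_eq (h3.trans hE.symm)]

theorem connectedComponent_eq_of_even (hE : finrank ℂ E = 3) {ω : E [⋀^Fin 3]→ₗ[ℂ] ℂ}
    (hω : ω ≠ 0) {P : QuadricPlane E} (hP : Even (finrank ℂ P.inter)) :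
    connectedComponent P = connectedComponent (splitPlane hE ⊥) := by
  have := finiteDimensional_of_finrank_eq_three hE
  have hle := finrank_inter_le hE P
  rw [connectedComponent_eq_splitPlane hE hω P]
  obtain h0 | h2 : finrank ℂ P.inter = 0 ∨ finrank ℂ P.inter = 2 := by
    obtain ⟨m, hm⟩ := hP
    omega
  · rw [Submodule.finrank_eq_zero.1 h0]
  · obtain ⟨x, hx⟩ : ∃ x, x ∉ P.inter := by
      by_contra! H
      rw [Submodule.eq_top_iff'.2 H, finrank_top] at h2
      omega
    have hx0 : x ≠ 0 := fun h => hx (h ▸ zero_mem _)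
    obtain ⟨T, hT, hker⟩ := exists_alternating_ker hE hx0
    -- A vector `e` of the new intersection lies in `K` with `T e ∈ K^⊥`. As `T e` also kills `x ∉
    -- K`, it is 0, so `e ∈ K ∩ ⟨x⟩ = 0`.
    obtain ⟨Q, hQ, hmem⟩ := exists_connectedComponent_eq (splitPlane hE P.inter) T hT
    have hbot : Q.inter = ⊥ := by
      rw [Submodule.eq_bot_iff]
      intro e he
      obtain ⟨h1, h3⟩ := mem_splitPlane.1 ((hmem e).1 he)
      have hTx : T x = 0 := (hker x).2 (Submodule.mem_span_singleton_self x)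
      have hex : T e x = 0 := by
        have := hT (e + x)
        simpa [hT, hTx] using this
      have hTe : T e = 0 := by
        by_contra hne
        exact hx (mem_of_apply_eq_zero hE h2 (neg_mem_iff.1 h3) hne hex)
      obtain ⟨c, hc⟩ := Submodule.mem_span_singleton.1 ((hker e).1 hTe)
      simp only at h1
      rw [← hc] at h1 ⊢
      by_contra hne
      exact hx ((Submodule.smul_mem_iff _ fun h => hne (by rw [h, zero_smul])).1 h1)
    rw [hQ, connectedComponent_eq_splitPlane hE hω Q, hbot]

/-! ### The two components and the conclusion -/

theorem connectedComponent_of_odd (hE : finrank ℂ E = 3) {ω : E [⋀^Fin 3]→ₗ[ℂ] ℂ} (hω : ω ≠ 0)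
    {P : QuadricPlane E} (hP : Odd (finrank ℂ P.inter)) :
    connectedComponent P = {Q | Odd (finrank ℂ Q.inter)} := by
  have hc : IsClopen {Q : QuadricPlane E | Odd (finrank ℂ Q.inter)} := by
    refine ⟨⟨?_⟩, isOpen_odd hE hω⟩
    convert isOpen_even hE hω using 1
    ext Q
    simp
  refine subset_antisymm (hc.connectedComponent_subset hP) fun Q hQ => ?_
  rw [connectedComponent_eq_of_odd hE hω hP, ← connectedComponent_eq_of_odd hE hω hQ]
  exact mem_connectedComponent

theorem connectedComponent_of_even (hE : finrank ℂ E = 3) {ω : E [⋀^Fin 3]→ₗ[ℂ] ℂ} (hω : ω ≠ 0)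
    {P : QuadricPlane E} (hP : Even (finrank ℂ P.inter)) :
    connectedComponent P = {Q | Even (finrank ℂ Q.inter)} := by
  have hc : IsClopen {Q : QuadricPlane E | Even (finrank ℂ Q.inter)} := by
    refine ⟨⟨?_⟩, isOpen_even hE hω⟩
    convert isOpen_odd hE hω using 1
    ext Q
    simp
  refine subset_antisymm (hc.connectedComponent_subset hP) fun Q hQ => ?_
  rw [connectedComponent_eq_of_even hE hω hP, ← connectedComponent_eq_of_even hE hω hQ]
  exact mem_connectedComponent

theorem exists_splitPlane_finrank_inter (hE : finrank ℂ E = 3) {d : ℕ} (hd : d ≤ 3) :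
    ∃ P : QuadricPlane E, finrank ℂ P.inter = d := by
  have := finiteDimensional_of_finrank_eq_three hE
  let b := finBasisOfFinrankEq ℂ E hE
  have hb : LinearIndependent ℂ (b ∘ Fin.castLE hd) :=
    b.linearIndependent.comp _ (Fin.castLE_injective hd)
  refine ⟨splitPlane hE (Submodule.span ℂ (Set.range (b ∘ Fin.castLE hd))), ?_⟩
  rw [inter_splitPlane, finrank_span_eq_card hb, Fintype.card_fin]

end Q4Planes

theorem lemma3p2 {E : Type*} [AddCommGroup E] [Module ℂ E] (hE : Module.finrank ℂ E = 3)
    (ω : E [⋀^Fin 3]→ₗ[ℂ] ℂ) (hω : ω ≠ 0) :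
    Nat.card (ConnectedComponents (Q4Planes.QuadricPlane E)) = 2 ∧
    ∀ P : Q4Planes.QuadricPlane E, ∃ P₁ P₂ : Q4Planes.QuadricPlane E,
      connectedComponent P = Q4Planes.planeOrbit hE hω P₁ ∪ Q4Planes.planeOrbit hE hω P₂ ∧
      Q4Planes.planeOrbit hE hω P₁ ≠ Q4Planes.planeOrbit hE hω P₂ ∧
      IsClosed (Q4Planes.planeOrbit hE hω P₁) ∧
      IsOpen (Q4Planes.planeOrbit hE hω P₂) := by
  open Q4Planes in
  have hle := finrank_inter_le hE
  obtain ⟨P₀, h₀⟩ := exists_splitPlane_finrank_inter (E := E) hE (d := 0) (by norm_num)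
  obtain ⟨P₁, h₁⟩ := exists_splitPlane_finrank_inter (E := E) hE (d := 1) (by norm_num)
  obtain ⟨P₂, h₂⟩ := exists_splitPlane_finrank_inter (E := E) hE (d := 2) (by norm_num)
  obtain ⟨P₃, h₃⟩ := exists_splitPlane_finrank_inter (E := E) hE (d := 3) (by norm_num)
  have hodd : Odd (finrank ℂ P₃.inter) := by rw [h₃]; decide
  have heven : Even (finrank ℂ P₀.inter) := by rw [h₀]; decide
  have hne : ∀ {A B : QuadricPlane E}, finrank ℂ A.inter ≠ finrank ℂ B.inter →
      planeOrbit hE hω A ≠ planeOrbit hE hω B := fun {A B} hAB h => by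
    rw [planeOrbit_eq, planeOrbit_eq] at h
    exact hAB (h.subset (rfl : A ∈ {Q | finrank ℂ Q.inter = finrank ℂ A.inter}))
  constructor
  · rw [Nat.card_eq_two_iff]
    refine ⟨ConnectedComponents.mk P₃, ConnectedComponents.mk P₀, ?_, ?_⟩
    · rw [Ne, ConnectedComponents.coe_eq_coe, connectedComponent_of_odd hE hω hodd,
        connectedComponent_of_even hE hω heven]
      intro h
      exact Nat.not_even_iff_odd.2 hodd (h.subset hodd)
    · refine Set.eq_univ_of_forall fun c => ?_
      obtain ⟨Q, rfl⟩ := ConnectedComponents.surjective_coe c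
      rw [Set.mem_insert_iff, Set.mem_singleton_iff, ConnectedComponents.coe_eq_coe,
        ConnectedComponents.coe_eq_coe]
      obtain h | h := Nat.even_or_odd (finrank ℂ Q.inter)
      · right
        rw [connectedComponent_of_even hE hω h, connectedComponent_of_even hE hω heven]
      · left
        rw [connectedComponent_of_odd hE hω h, connectedComponent_of_odd hE hω hodd]
  · intro P
    obtain h | h := Nat.even_or_odd (finrank ℂ P.inter)
    · refine ⟨P₂, P₀, ?_, hne (by omega), ?_, ?_⟩
      · rw [connectedComponent_of_even hE hω h, planeOrbit_eq, planeOrbit_eq, h₀, h₂]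
        ext Q
        have := hle Q
        simp only [Set.mem_ofPred_eq, Set.mem_union, Nat.even_iff]
        omega
      · rw [planeOrbit_eq, h₂]
        constructor
        -- The complement of the level `d = 2` is `d` odd or `d = 0`.
        convert (isOpen_odd hE hω).union (isOpen_finrank_inter_eq_zero hE) using 1
        ext Q
        have := hle Q
        simp only [Set.mem_ofPred_eq, Set.mem_union, Nat.odd_iff, Set.mem_compl_iff]
        omega
      · rw [planeOrbit_eq, h₀]
        exact isOpen_finrank_inter_eq_zero hE
    · refine ⟨P₃, P₁, ?_, hne (by omega), ?_, ?_⟩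
      · rw [connectedComponent_of_odd hE hω h, planeOrbit_eq, planeOrbit_eq, h₁, h₃]
        ext Q
        have := hle Q
        simp only [Set.mem_ofPred_eq, Set.mem_union, Nat.odd_iff]
        omega
      · rw [planeOrbit_eq, h₃]
        exact ⟨isOpen_finrank_inter_ne_three hE⟩
      · rw [planeOrbit_eq, h₁]
        -- The level `d = 1` is `d` odd and `d ≠ 3`.
        convert (isOpen_odd hE hω).inter (isOpen_finrank_inter_ne_three hE) using 1
        ext Q
        have := hle Q
        simp only [Set.mem_ofPred_eq, Set.mem_inter_iff, Nat.odd_iff]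
        omega
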